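/- Let $Z\subseteq\mathbb{R}^d$ be open (for instance $Z=\mathbb{R}^d$), let $C:Z\to\mathbb{R}$ be continuously differentiable with $\nabla C(z)\neq 0$ whenever $C(z)=0$, and let $\tilde S$ be either the volume type set $\{z\in Z: C(z)\ge 0\}$, in which case a function $\xi:Z\to(0,\infty)$ is given, or the surface type set $\{z\in Z: C(z)=0\}$, in which case $\xi\equiv 0$. Let $P$ assign to each $z\in Z$ a point $Pz\in\arg\min_{s\in\tilde S}\|z-s\|^2$. Let $q$ be a real-valued convex function on the convex hull of $Z$, let $\sigma:\mathbb{R}\to[0,\infty)$ be convex and nondecreasing with $\sigma(0)=0$, let $\varepsilon>0$, and put $$V(z)=\sigma\bigl(q(z)-q(Pz)\bigr)+\varepsilon\|z-Pz\|^2 ,$$ where it is assumed that $V$ is differentiable at every point of $Z\setminus\tilde S$. Let $h:Z\to\mathbb{R}^d$ be arbitrary, $\alpha\ge 0$, $\eta:Z\to[0,\infty)$, let $u(a)=1$ for $a\ge0$ and $u(a)=0$ for $a<0$, and put $\beta(z)=\nabla V(z)^{\mathsf T}h(z)+\alpha V(z)$, $$g(z)=\begin{cases}h(z), & z\in\tilde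 S,\\ h(z)-u(\beta(z))\,\dfrac{\beta(z)+\eta(z)}{\|\nabla V(z)\|^2}\,\nabla V(z), & z\notin\tilde S,\end{cases}$$ $$\tilde f(z)=\begin{cases}g(z)-\dfrac{\nabla C(z)^{\mathsf T}g(z)-\xi(z)}{\|\nabla C(z)\|^2}\,\nabla C(z), & C(z)=0,\\ g(z), & C(z)\neq0.\end{cases}$$ A solution of $\dot z=\tilde f(z)$ on $[0,T)$, $0<T\le\infty$, is a continuous $z:[0,T)\to Z$ whose right derivative at every $t\in[0,T)$ exists and equals $\tilde f(z(t))$ (so all classical solutions are included). Write $\operatorname{dist}(z,\tilde S)=\inf_{s\in\tilde S}\|z-s\|$. Then: 1. $\tilde S$ is positively invariant for $\dot z=\tilde f(z)$: every solution with $z(0)\in\tilde S$ satisfies $z(t)\in\tilde S$ for all $t$ in its interval $[0,T)$. 2. Suppose moreover that, for some $r>0$, $q$ is uniformly continuous on $\{z\in Z:\operatorname{dist}(z,\tilde S)<r\}$ (this is automatic if $\tilde S$ is compact, and if $q$ is Lipschitz). Then $\tilde S$ is stable: for every $e>0$ there is $\delta>0$ such that every solution with $\operatorname{dist}(z(0),\tilde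 S)<\delta$ satisfies $\operatorname{dist}(z(t),\tilde S)<e$ for all $t\in[0,T)$. If in addition $\alpha>0$, then $\tilde S$ is asymptotically stable: it is stable, and $\operatorname{dist}(z(t),\tilde S)\to0$ as $t\to\infty$ for every solution on $[0,\infty)$. -/

import Mathlib

open Set Filter Topology Metric

noncomputable section

/-- `z : ℝ → ℝ^d` is a solution in the state space `Z` of the differential equation `ż = F(z)` on
the time interval `I` (below `[0, T)` or `[0, ∞)`): it is continuous and has the right derivative
`F (z t)` at every time. Every classical solution is one, and the two notions agree when `F` is
continuous; for a discontinuous `F` a solution may have a corner where it meets a discontinuity. -/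
def IsSolutionOn {d : ℕ} (F : EuclideanSpace ℝ (Fin d) → EuclideanSpace ℝ (Fin d))
    (Z : Set (EuclideanSpace ℝ (Fin d))) (I : Set ℝ) (z : ℝ → EuclideanSpace ℝ (Fin d)) : Prop :=
  ContinuousOn z I ∧ ∀ t ∈ I, z t ∈ Z ∧ HasDerivWithinAt z (F (z t)) (Ici t) t

/-- Positive invariance: every solution that starts in `S` stays in `S` for as long as it exists
(a solution on `[0, ∞)` is covered through its restrictions to the intervals `[0, T)`). -/
def IsPositivelyInvariant {d : ℕ} (F : EuclideanSpace ℝ (Fin d) → EuclideanSpace ℝ (Fin d))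
    (Z S : Set (EuclideanSpace ℝ (Fin d))) : Prop :=
  ∀ (T : ℝ) (z : ℝ → EuclideanSpace ℝ (Fin d)), 0 < T → IsSolutionOn F Z (Ico 0 T) z →
    z 0 ∈ S → ∀ t ∈ Ico 0 T, z t ∈ S

/-- Lyapunov stability of a set: for every `e > 0` there is `δ > 0` such that every solution with
`dist (z 0, S) < δ` satisfies `dist (z t, S) < e` for as long as it exists. -/
def IsStable {d : ℕ} (F : EuclideanSpace ℝ (Fin d) → EuclideanSpace ℝ (Fin d))
    (Z S : Set (EuclideanSpace ℝ (Fin d))) : Prop :=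
  ∀ e : ℝ, 0 < e → ∃ δ : ℝ, 0 < δ ∧
    ∀ (T : ℝ) (z : ℝ → EuclideanSpace ℝ (Fin d)), 0 < T → IsSolutionOn F Z (Ico 0 T) z →
      infDist (z 0) S < δ → ∀ t ∈ Ico 0 T, infDist (z t) S < e

/-- Asymptotic stability of a set: it is stable, and the distance to it tends to `0` along every
solution on `[0, ∞)`, whatever the initial state. -/
def IsAsymptoticallyStable {d : ℕ}
    (F : EuclideanSpace ℝ (Fin d) → EuclideanSpace ℝ (Fin d))
    (Z S : Set (EuclideanSpace ℝ (Fin d))) : Prop :=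
  IsStable F Z S ∧
    ∀ z : ℝ → EuclideanSpace ℝ (Fin d), IsSolutionOn F Z (Ici 0) z →
      Tendsto (fun t => infDist (z t) S) atTop (𝓝 0)

/-- The volume type latent set `{C ≥ 0}` in the state space `Z`. -/
def volSet {d : ℕ} (Z : Set (EuclideanSpace ℝ (Fin d))) (C : EuclideanSpace ℝ (Fin d) → ℝ) :
    Set (EuclideanSpace ℝ (Fin d)) :=
  {z | z ∈ Z ∧ 0 ≤ C z}

/-- The surface type latent set `{C = 0}` in the state space `Z`. -/
def surfSet {d : ℕ} (Z : Set (EuclideanSpace ℝ (Fin d))) (C : EuclideanSpace ℝ (Fin d) → ℝ) :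
    Set (EuclideanSpace ℝ (Fin d)) :=
  {z | z ∈ Z ∧ C z = 0}

/-- `P` is an orthogonal projection of `Z` onto `S`: `P z ∈ argmin_{s ∈ S} ‖z - s‖²`. -/
def IsOrthProjOnto {d : ℕ} (Z S : Set (EuclideanSpace ℝ (Fin d)))
    (P : EuclideanSpace ℝ (Fin d) → EuclideanSpace ℝ (Fin d)) : Prop :=
  ∀ z ∈ Z, P z ∈ S ∧ ∀ s ∈ S, ‖z - P z‖ ^ 2 ≤ ‖z - s‖ ^ 2

/-- The Lyapunov candidate `V(z) = σ(q(z) - q(P z)) + ε ‖z - P z‖²`. -/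
def lyapunovCandidate {d : ℕ} (σ : ℝ → ℝ) (q : EuclideanSpace ℝ (Fin d) → ℝ)
    (P : EuclideanSpace ℝ (Fin d) → EuclideanSpace ℝ (Fin d)) (ε : ℝ)
    (z : EuclideanSpace ℝ (Fin d)) : ℝ :=
  σ (q z - q (P z)) + ε * ‖z - P z‖ ^ 2

/-- The unit step function. -/
def unitStep (a : ℝ) : ℝ := if 0 ≤ a then 1 else 0

/-- `β(z) = ∇V(z)ᵀ h(z) + α V(z)`. -/
def betaFun {d : ℕ} (h : EuclideanSpace ℝ (Fin d) → EuclideanSpace ℝ (Fin d))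
    (V : EuclideanSpace ℝ (Fin d) → ℝ) (α : ℝ) (z : EuclideanSpace ℝ (Fin d)) : ℝ :=
  inner ℝ (gradient V z) (h z) + α * V z

open Classical in
/-- The first correction `g` of the base model `h`, ensuring that `V` decreases off `S`. -/
def stabilizedField {d : ℕ} (S : Set (EuclideanSpace ℝ (Fin d)))
    (h : EuclideanSpace ℝ (Fin d) → EuclideanSpace ℝ (Fin d))
    (V : EuclideanSpace ℝ (Fin d) → ℝ) (α : ℝ) (η : EuclideanSpace ℝ (Fin d) → ℝ)
    (z : EuclideanSpace ℝ (Fin d)) : EuclideanSpace ℝ (Fin d) :=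
  if z ∈ S then h z
  else h z - (unitStep (betaFun h V α z) *
    ((betaFun h V α z + η z) / ‖gradient V z‖ ^ 2)) • gradient V z

/-- The second correction of a vector field `g`, on `{C = 0}`, with
`γ(z) = ∇C(z)ᵀ g(z)`. -/
def invariantField {d : ℕ} (C : EuclideanSpace ℝ (Fin d) → ℝ)
    (ξ : EuclideanSpace ℝ (Fin d) → ℝ)
    (g : EuclideanSpace ℝ (Fin d) → EuclideanSpace ℝ (Fin d))
    (z : EuclideanSpace ℝ (Fin d)) : EuclideanSpace ℝ (Fin d) :=
  if C z = 0 then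
    g z - ((inner ℝ (gradient C z) (g z) - ξ z) / ‖gradient C z‖ ^ 2) • gradient C z
  else g z

/-- The modified latent vector field `f̃` built from the base model `h`. -/
def latentField {d : ℕ} (S : Set (EuclideanSpace ℝ (Fin d)))
    (C : EuclideanSpace ℝ (Fin d) → ℝ)
    (h : EuclideanSpace ℝ (Fin d) → EuclideanSpace ℝ (Fin d))
    (V : EuclideanSpace ℝ (Fin d) → ℝ) (α : ℝ) (η ξ : EuclideanSpace ℝ (Fin d) → ℝ) :
    EuclideanSpace ℝ (Fin d) → EuclideanSpace ℝ (Fin d) :=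
  invariantField C ξ (stabilizedField S h V α η)

end

section

variable {d : ℕ}

/-! Everything follows from `exp (α t) * V (z t)` being nonincreasing along solutions. Off `S` one
has `C ≠ 0`, so only the first correction acts there, and it forces `⟪∇V, F⟫ ≤ -α V` provided `∇V ≠
0`. The latter is the heart of the matter (`gradient_lyapunovCandidate_ne_zero`): the projection is
constant on the segment from `z` to `P z`, so convexity makes `V` shrink at least linearly along it,
with slope at most `-V z < 0`. As `V` vanishes exactly on `S`, its decay gives invariance. Stability
and attraction follow from `ε dist² ≤ V`, the former also from the uniform smallness of `V` near
`S`. -/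

/-! ### Orthogonal projections -/

theorem orthProj_norm_le {Z S : Set (EuclideanSpace ℝ (Fin d))}
    {P : EuclideanSpace ℝ (Fin d) → EuclideanSpace ℝ (Fin d)} (hP : IsOrthProjOnto Z S P)
    {z s : EuclideanSpace ℝ (Fin d)} (hz : z ∈ Z) (hs : s ∈ S) : ‖z - P z‖ ≤ ‖z - s‖ :=
  le_of_sq_le_sq ((hP z hz).2 s hs) (norm_nonneg _)

theorem orthProj_eq_self {Z S : Set (EuclideanSpace ℝ (Fin d))}
    {P : EuclideanSpace ℝ (Fin d) → EuclideanSpace ℝ (Fin d)} (hP : IsOrthProjOnto Z S P)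
    {z : EuclideanSpace ℝ (Fin d)} (hz : z ∈ Z) (hs : z ∈ S) : P z = z := by
  have h := orthProj_norm_le hP hz hs
  rw [sub_self, norm_zero] at h
  exact (sub_eq_zero.1 (norm_le_zero_iff.1 h)).symm

theorem infDist_eq_norm_sub_orthProj {Z S : Set (EuclideanSpace ℝ (Fin d))}
    {P : EuclideanSpace ℝ (Fin d) → EuclideanSpace ℝ (Fin d)} (hP : IsOrthProjOnto Z S P)
    {z : EuclideanSpace ℝ (Fin d)} (hz : z ∈ Z) : infDist z S = ‖z - P z‖ := by
  apply le_antisymm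
  · rw [← dist_eq_norm]
    exact infDist_le_dist_of_mem (hP z hz).1
  · refine (le_infDist ⟨_, (hP z hz).1⟩).2 fun s hs => ?_
    rw [dist_eq_norm]
    exact orthProj_norm_le hP hz hs

/-- The orthogonal projection is constant along the segment from `z` to its projection. -/
theorem orthProj_segment {Z S : Set (EuclideanSpace ℝ (Fin d))}
    {P : EuclideanSpace ℝ (Fin d) → EuclideanSpace ℝ (Fin d)} (hP : IsOrthProjOnto Z S P)
    {z : EuclideanSpace ℝ (Fin d)} (hz : z ∈ Z) {s : ℝ} (hs0 : 0 < s) (hs1 : s < 1)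
    (hzs : z + s • (P z - z) ∈ Z) : P (z + s • (P z - z)) = P z := by
  set w := z + s • (P z - z) with hw
  have hzw : z - w = s • (z - P z) := by rw [hw]; module
  have hwP : w - P z = (1 - s) • (z - P z) := by rw [hw]; module
  have h1 : ‖w - P w‖ ≤ (1 - s) * ‖z - P z‖ := by
    have := orthProj_norm_le hP hzs (hP z hz).1
    rwa [hwP, norm_smul, Real.norm_of_nonneg (by linarith)] at this
  have h2 : ‖z - P z‖ ≤ ‖z - P w‖ := orthProj_norm_le hP hz (hP w hzs).1
  have h3 : ‖z - w‖ = s * ‖z - P z‖ := by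
    rw [hzw, norm_smul, Real.norm_of_nonneg hs0.le]
  have h4 : ‖z - P w‖ ≤ ‖z - w‖ + ‖w - P w‖ := norm_sub_le_norm_sub_add_norm_sub _ _ _
  -- Equality holds throughout `‖z - P z‖ ≤ ‖z - P w‖ ≤ ‖z - w‖ + ‖w - P w‖ ≤ ‖z - P z‖`. By strict
  -- convexity of the norm, `w - P w` is then a nonnegative multiple of `z - w` (if `z ≠ w`), and
  -- its length identifies `P w`.
  have h5 : ‖w - P w‖ = (1 - s) * ‖z - P z‖ := by linarith
  have hray : SameRay ℝ (z - w) (w - P w) := by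
    rw [sameRay_iff_norm_add, sub_add_sub_cancel]
    linarith
  have h6 := hray.norm_smul_eq
  rw [h3, h5, hzw, smul_smul] at h6
  rcases eq_or_ne (‖z - P z‖) 0 with h0 | h0
  · have e1 : w = P w := by
      rw [← sub_eq_zero, ← norm_eq_zero, h5, h0, mul_zero]
    have e2 : w = P z := by
      rw [← sub_eq_zero, hwP, norm_eq_zero.1 h0, smul_zero]
    rw [← e1, e2]
  · have h7 : (s * ‖z - P z‖) • (w - P w) = (s * ‖z - P z‖) • (w - P z) := by
      rw [h6, hwP, smul_smul]
      ring_nf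
    have h8 := smul_right_injective _ (mul_ne_zero hs0.ne' h0) h7
    exact sub_right_injective h8

/-! ### The Lyapunov candidate -/

theorem lyapunovCandidate_lower_bound {σ : ℝ → ℝ} (hσ_nonneg : ∀ a, 0 ≤ σ a)
    (q : EuclideanSpace ℝ (Fin d) → ℝ) (P : EuclideanSpace ℝ (Fin d) → EuclideanSpace ℝ (Fin d))
    (ε : ℝ) (z : EuclideanSpace ℝ (Fin d)) :
    ε * ‖z - P z‖ ^ 2 ≤ lyapunovCandidate σ q P ε z :=
  le_add_of_nonneg_left (hσ_nonneg _)

theorem lyapunovCandidate_eq_zero {Z S : Set (EuclideanSpace ℝ (Fin d))}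
    {P : EuclideanSpace ℝ (Fin d) → EuclideanSpace ℝ (Fin d)} (hP : IsOrthProjOnto Z S P)
    {σ : ℝ → ℝ} (hσ_zero : σ 0 = 0) (q : EuclideanSpace ℝ (Fin d) → ℝ) (ε : ℝ)
    {z : EuclideanSpace ℝ (Fin d)} (hz : z ∈ Z) (hs : z ∈ S) :
    lyapunovCandidate σ q P ε z = 0 := by
  simp [lyapunovCandidate, orthProj_eq_self hP hz hs, hσ_zero]

theorem lyapunovCandidate_pos {Z S : Set (EuclideanSpace ℝ (Fin d))}
    {P : EuclideanSpace ℝ (Fin d) → EuclideanSpace ℝ (Fin d)} (hP : IsOrthProjOnto Z S P)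
    {σ : ℝ → ℝ} (hσ_nonneg : ∀ a, 0 ≤ σ a) (q : EuclideanSpace ℝ (Fin d) → ℝ) {ε : ℝ}
    (hε : 0 < ε) {z : EuclideanSpace ℝ (Fin d)} (hz : z ∈ Z) (hs : z ∉ S) :
    0 < lyapunovCandidate σ q P ε z := by
  refine lt_of_lt_of_le ?_ (lyapunovCandidate_lower_bound hσ_nonneg q P ε z)
  have : z - P z ≠ 0 := fun h => hs (sub_eq_zero.1 h ▸ (hP z hz).1)
  have := norm_pos_iff.2 this
  positivity

/-- Since `P` does not change along the segment, `q (P z)` is a constant there. Convexity of `q`,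
then of `σ` with `σ 0 = 0`, yields the factor `1 - s`; the squared norm even gains `(1 - s) ^ 2`. -/
theorem lyapunovCandidate_segment_le {Z S : Set (EuclideanSpace ℝ (Fin d))}
    {P : EuclideanSpace ℝ (Fin d) → EuclideanSpace ℝ (Fin d)} (hP : IsOrthProjOnto Z S P)
    (hSZ : S ⊆ Z) {q : EuclideanSpace ℝ (Fin d) → ℝ} (hq : ConvexOn ℝ (convexHull ℝ Z) q)
    {σ : ℝ → ℝ} (hσ : ConvexOn ℝ Set.univ σ) (hσ_mono : Monotone σ) (hσ_zero : σ 0 = 0)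
    {ε : ℝ} (hε : 0 < ε) {z : EuclideanSpace ℝ (Fin d)} (hz : z ∈ Z) {s : ℝ} (hs0 : 0 < s)
    (hs1 : s < 1) (hzs : z + s • (P z - z) ∈ Z) :
    lyapunovCandidate σ q P ε (z + s • (P z - z)) ≤ (1 - s) * lyapunovCandidate σ q P ε z := by
  have hPs := orthProj_segment hP hz hs0 hs1 hzs
  have hw : z + s • (P z - z) = (1 - s) • z + s • P z := by module
  have hqle : q (z + s • (P z - z)) ≤ (1 - s) * q z + s * q (P z) := by
    rw [hw]
    exact hq.2 (subset_convexHull ℝ Z hz) (subset_convexHull ℝ Z (hSZ (hP z hz).1))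
      (by linarith) hs0.le (by ring)
  have hσle : σ (q (z + s • (P z - z)) - q (P z)) ≤ (1 - s) * σ (q z - q (P z)) := by
    calc σ (q (z + s • (P z - z)) - q (P z))
        ≤ σ ((1 - s) • (q z - q (P z)) + s • (0 : ℝ)) :=
          hσ_mono (by simp only [smul_eq_mul]; linarith)
      _ ≤ (1 - s) • σ (q z - q (P z)) + s • σ 0 :=
          hσ.2 (mem_univ _) (mem_univ _) (by linarith) hs0.le (by ring)
      _ = (1 - s) * σ (q z - q (P z)) := by rw [hσ_zero, smul_zero, add_zero, smul_eq_mul]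
  have hn : ‖z + s • (P z - z) - P z‖ = (1 - s) * ‖z - P z‖ := by
    rw [show z + s • (P z - z) - P z = (1 - s) • (z - P z) by module, norm_smul,
      Real.norm_of_nonneg (by linarith)]
  have hsq : ((1 - s) * ‖z - P z‖) ^ 2 ≤ (1 - s) * ‖z - P z‖ ^ 2 := by
    rw [mul_pow]
    exact mul_le_mul_of_nonneg_right (by nlinarith) (sq_nonneg _)
  have := mul_le_mul_of_nonneg_left hsq hε.le
  unfold lyapunovCandidate
  rw [hPs, hn]
  linarith

theorem gradient_lyapunovCandidate_ne_zero {Z S : Set (EuclideanSpace ℝ (Fin d))}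
    (hZ : IsOpen Z) {P : EuclideanSpace ℝ (Fin d) → EuclideanSpace ℝ (Fin d)}
    (hP : IsOrthProjOnto Z S P) (hSZ : S ⊆ Z) {q : EuclideanSpace ℝ (Fin d) → ℝ}
    (hq : ConvexOn ℝ (convexHull ℝ Z) q) {σ : ℝ → ℝ} (hσ : ConvexOn ℝ Set.univ σ)
    (hσ_nonneg : ∀ a, 0 ≤ σ a) (hσ_mono : Monotone σ) (hσ_zero : σ 0 = 0) {ε : ℝ} (hε : 0 < ε)
    {z : EuclideanSpace ℝ (Fin d)} (hz : z ∈ Z) (hs : z ∉ S)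
    (hV : DifferentiableAt ℝ (lyapunovCandidate σ q P ε) z) :
    gradient (lyapunovCandidate σ q P ε) z ≠ 0 := by
  intro hgrad
  set V := lyapunovCandidate σ q P ε with hVdef
  have hpos : 0 < V z := lyapunovCandidate_pos hP hσ_nonneg q hε hz hs
  have hf0 : fderiv ℝ V z (P z - z) = 0 := by
    rw [← inner_gradient_left, hgrad, inner_zero_left]
  have hc : HasDerivAt (fun s : ℝ => z + s • (P z - z)) (P z - z) 0 := by
    simpa using ((hasDerivAt_id (0 : ℝ)).smul_const (P z - z)).const_add z
  have hd : HasDerivAt (fun s : ℝ => V (z + s • (P z - z))) 0 0 := by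
    have hV' : HasFDerivAt V (fderiv ℝ V z) (z + (0 : ℝ) • (P z - z)) := by
      simpa using hV.hasFDerivAt
    have := hV'.comp_hasDerivAt (0 : ℝ) hc
    rwa [hf0] at this
  have hlim := hd.tendsto_slope_zero_right
  have hmem : ∀ᶠ s : ℝ in 𝓝[>] 0, z + s • (P z - z) ∈ Z := by
    refine nhdsWithin_le_nhds (hc.continuousAt.eventually_mem ?_)
    simpa using hZ.mem_nhds hz
  have hlt : ∀ᶠ s : ℝ in 𝓝[>] 0, s < 1 := nhdsWithin_le_nhds (gt_mem_nhds one_pos)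
  -- The right difference quotients towards `P z` are at most `-V z`, yet a vanishing gradient makes
  -- them tend to `0`.
  have hle : (0 : ℝ) ≤ -V z := by
    refine le_of_tendsto hlim ?_
    filter_upwards [hmem, hlt, self_mem_nhdsWithin] with s h1 h2 h3
    have h3 : 0 < s := h3
    have h4 : V (z + s • (P z - z)) ≤ (1 - s) * V z :=
      lyapunovCandidate_segment_le hP hSZ hq hσ hσ_mono hσ_zero hε hz h3 h2 h1
    simp only [zero_add, zero_smul, add_zero, smul_eq_mul]
    rw [inv_mul_le_iff₀ h3]
    linarith
  linarith

/-- `P` may jump off `S`, but there `V` is differentiable. At `z ∈ S` the bound `‖P w - z‖ ≤ 2 ‖w -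
z‖` makes `P` continuous, and convex functions are continuous on open sets. -/
theorem continuousOn_lyapunovCandidate {Z S : Set (EuclideanSpace ℝ (Fin d))}
    (hZ : IsOpen Z) {P : EuclideanSpace ℝ (Fin d) → EuclideanSpace ℝ (Fin d)}
    (hP : IsOrthProjOnto Z S P) {q : EuclideanSpace ℝ (Fin d) → ℝ}
    (hq : ConvexOn ℝ (convexHull ℝ Z) q) {σ : ℝ → ℝ} (hσ : ConvexOn ℝ Set.univ σ) {ε : ℝ}
    (hV : ∀ z ∈ Z, z ∉ S → DifferentiableAt ℝ (lyapunovCandidate σ q P ε) z) :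
    ContinuousOn (lyapunovCandidate σ q P ε) Z := by
  intro z hz
  by_cases hs : z ∈ S
  · have hqc : ContinuousAt q z := ((hq.continuousOn hZ.convexHull).mono
      (subset_convexHull ℝ Z)).continuousAt (hZ.mem_nhds hz)
    have hσc : Continuous σ := continuousOn_univ.1 (hσ.continuousOn isOpen_univ)
    have hPz := orthProj_eq_self hP hz hs
    have hPc : ContinuousWithinAt P Z z := by
      have hid : Tendsto (fun w => ‖w - z‖ + ‖w - z‖) (𝓝[Z] z) (𝓝 0) := by
        have : Continuous fun w : EuclideanSpace ℝ (Fin d) => ‖w - z‖ + ‖w - z‖ := by fun_prop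
        simpa using (this.tendsto z).mono_left nhdsWithin_le_nhds
      rw [ContinuousWithinAt, hPz, tendsto_iff_norm_sub_tendsto_zero]
      refine squeeze_zero' (Eventually.of_forall fun _ => norm_nonneg _) ?_ hid
      filter_upwards [self_mem_nhdsWithin] with w hw
      have h1 := orthProj_norm_le hP hw hs
      have h2 := norm_sub_le_norm_sub_add_norm_sub (P w) w z
      rw [norm_sub_rev (P w) w] at h2
      linarith
    have hqP : ContinuousWithinAt (fun w => q (P w)) Z z := by
      have : ContinuousAt q (P z) := by rwa [hPz]
      exact this.comp_continuousWithinAt hPc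
    unfold lyapunovCandidate
    exact (hσc.continuousAt.comp_continuousWithinAt (hqc.continuousWithinAt.sub hqP)).add
      (continuousWithinAt_const.mul ((continuousWithinAt_id.sub hPc).norm.pow 2))
  · exact (hV z hz hs).continuousAt.continuousWithinAt

/-! ### Decay along solutions, smallness near `S` -/

/-- The first correction makes the Lyapunov candidate decay at rate `α` wherever its gradient does
not vanish. -/
theorem inner_gradient_latentField_le {S : Set (EuclideanSpace ℝ (Fin d))}
    {C : EuclideanSpace ℝ (Fin d) → ℝ} {h : EuclideanSpace ℝ (Fin d) → EuclideanSpace ℝ (Fin d)}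
    {V : EuclideanSpace ℝ (Fin d) → ℝ} {α : ℝ} {η ξ : EuclideanSpace ℝ (Fin d) → ℝ}
    {z : EuclideanSpace ℝ (Fin d)} (hs : z ∉ S) (hCz : C z ≠ 0) (hη : 0 ≤ η z)
    (hgrad : gradient V z ≠ 0) :
    inner ℝ (gradient V z) (latentField S C h V α η ξ z) ≤ -α * V z := by
  have hn : ‖gradient V z‖ ^ 2 ≠ 0 := pow_ne_zero _ (norm_ne_zero_iff.2 hgrad)
  rw [latentField, invariantField, if_neg hCz, stabilizedField, if_neg hs, inner_sub_right,
    inner_smul_right, real_inner_self_eq_norm_sq, mul_assoc, div_mul_cancel₀ _ hn]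
  have hβ : betaFun h V α z = inner ℝ (gradient V z) (h z) + α * V z := rfl
  unfold unitStep
  -- If `β ≥ 0`, the inner product is `-α V - η`; if `β < 0`, the uncorrected field already
  -- satisfies the bound.
  split_ifs <;> linarith

/-- A nonnegative continuous function with nonpositive right derivative wherever it is positive
does not increase. -/
theorem le_of_deriv_right_nonpos_of_pos {φ : ℝ → ℝ} {a b : ℝ} (hab : a ≤ b)
    (hφ : ContinuousOn φ (Icc a b)) (hnn : 0 ≤ φ a)
    (hder : ∀ t ∈ Ico a b, 0 < φ t → ∃ D ≤ 0, HasDerivWithinAt φ D (Ici t) t) : φ b ≤ φ a := by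
  by_contra! hlt
  have hclosed : IsClosed (Icc a b ∩ φ ⁻¹' Iic (φ a)) :=
    hφ.preimage_isClosed_of_isClosed isClosed_Icc isClosed_Iic
  have hcomp : IsCompact (Icc a b ∩ φ ⁻¹' Iic (φ a)) :=
    isCompact_Icc.of_isClosed_subset hclosed inter_subset_left
  -- `c` is the last time with `φ ≤ φ a`. After it `φ > φ a ≥ 0`, so the derivative hypothesis
  -- applies on all of `(c, b]`; then let `s` decrease to `c`.
  obtain ⟨c, ⟨hc, hca⟩, hcmax⟩ := hcomp.exists_isGreatest ⟨a, left_mem_Icc.2 hab, le_refl (φ a)⟩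
  have hca : φ c ≤ φ a := hca
  have hcb : c < b := lt_of_le_of_ne hc.2 fun h => absurd hca (h ▸ hlt.not_ge)
  have hgt : ∀ t ∈ Ioc c b, φ a < φ t := fun t ht => by
    by_contra! h
    exact ht.1.not_ge (hcmax ⟨⟨hc.1.trans ht.1.le, ht.2⟩, h⟩)
  have hle : ∀ s ∈ Ioc c b, φ b ≤ φ s := by
    intro s hs
    have hsub : Icc s b ⊆ Icc a b := Icc_subset_Icc_left (hc.1.trans hs.1.le)
    choose! D hD0 hD using hder
    refine image_le_of_deriv_right_le_deriv_boundary (f' := D) (B := fun _ => φ s)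
      (B' := fun _ => 0) (hφ.mono hsub) (fun t ht => ?_) le_rfl continuousOn_const
      (fun _ _ => hasDerivWithinAt_const _ _ _) (fun t ht => ?_) (right_mem_Icc.2 hs.2)
    all_goals have htp : 0 < φ t := hnn.trans_lt (hgt t ⟨hs.1.trans_le ht.1, ht.2.le⟩)
    all_goals have hta : t ∈ Ico a b := ⟨hc.1.trans (hs.1.le.trans ht.1), ht.2⟩
    · exact hD t hta htp
    · exact hD0 t hta htp
  have hlim : Tendsto φ (𝓝[>] c) (𝓝 (φ c)) := by
    have := (hφ c hc).mono (Icc_subset_Icc_left hc.1)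
    exact (this.mono Ioc_subset_Icc_self).mono_left (nhdsWithin_Ioc_eq_nhdsGT hcb).ge
  have : φ b ≤ φ c := by
    refine ge_of_tendsto hlim ?_
    filter_upwards [Ioc_mem_nhdsGT hcb] with s hs using hle s hs
  linarith

/-- Along a solution a continuous function `V ≥ 0` that vanishes exactly on `S` and
decreases at rate `α` off `S` decays at rate `α`. -/
theorem exp_mul_comp_solution_le {Z S : Set (EuclideanSpace ℝ (Fin d))}
    {F : EuclideanSpace ℝ (Fin d) → EuclideanSpace ℝ (Fin d)}
    {V : EuclideanSpace ℝ (Fin d) → ℝ} {α : ℝ} (hVc : ContinuousOn V Z)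
    (hV0 : ∀ z ∈ Z, z ∈ S → V z = 0) (hVpos : ∀ z ∈ Z, z ∉ S → 0 < V z)
    (hVd : ∀ z ∈ Z, z ∉ S → DifferentiableAt ℝ V z)
    (hdec : ∀ z ∈ Z, z ∉ S → inner ℝ (gradient V z) (F z) ≤ -α * V z)
    {T : ℝ} {z : ℝ → EuclideanSpace ℝ (Fin d)} (hz : IsSolutionOn F Z (Ico 0 T) z)
    {a b : ℝ} (ha : 0 ≤ a) (hab : a ≤ b) (hb : b < T) :
    Real.exp (α * b) * V (z b) ≤ Real.exp (α * a) * V (z a) := by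
  have hsub : Icc a b ⊆ Ico 0 T := fun t ht => ⟨ha.trans ht.1, ht.2.trans_lt hb⟩
  have hmem : ∀ t ∈ Icc a b, z t ∈ Z := fun t ht => (hz.2 t (hsub ht)).1
  set φ : ℝ → ℝ := fun t => Real.exp (α * t) * V (z t) with hφ
  have hφc : ContinuousOn φ (Icc a b) :=
    (by fun_prop : Continuous fun t : ℝ => Real.exp (α * t)).continuousOn.mul
      (hVc.comp (hz.1.mono hsub) hmem)
  have hφder : ∀ t ∈ Ico a b, 0 < φ t → ∃ D ≤ 0, HasDerivWithinAt φ D (Ici t) t := by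
    intro t ht hpos
    have htm := hmem t (Ico_subset_Icc_self ht)
    have hs : z t ∉ S := fun hs => by simp [hφ, hV0 _ htm hs] at hpos
    have h1 : HasDerivWithinAt (fun t => V (z t)) (fderiv ℝ V (z t) (F (z t))) (Ici t) t :=
      (hVd _ htm hs).hasFDerivAt.comp_hasDerivWithinAt t
        (hz.2 t (hsub (Ico_subset_Icc_self ht))).2
    have h2 : HasDerivAt (fun t : ℝ => Real.exp (α * t)) (Real.exp (α * t) * α) t := by
      simpa using ((hasDerivAt_id t).const_mul α).exp
    refine ⟨_, ?_, h2.hasDerivWithinAt.mul h1⟩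
    have h3 := hdec _ htm hs
    rw [inner_gradient_left] at h3
    have h4 := mul_le_mul_of_nonneg_left h3 (Real.exp_pos (α * t)).le
    linarith
  refine le_of_deriv_right_nonpos_of_pos hab hφc ?_ hφder
  refine mul_nonneg (Real.exp_pos _).le ?_
  have htm := hmem a (left_mem_Icc.2 hab)
  by_cases hs : z a ∈ S
  · exact (hV0 _ htm hs).ge
  · exact (hVpos _ htm hs).le

/-- If `q` is uniformly continuous near `S`, the Lyapunov candidate is uniformly small near `S`. -/
theorem lyapunovCandidate_uniform_small {Z S : Set (EuclideanSpace ℝ (Fin d))}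
    {P : EuclideanSpace ℝ (Fin d) → EuclideanSpace ℝ (Fin d)} (hP : IsOrthProjOnto Z S P)
    (hSZ : S ⊆ Z) {q : EuclideanSpace ℝ (Fin d) → ℝ} {r : ℝ} (hr : 0 < r)
    (hunif : UniformContinuousOn q (Z ∩ Metric.thickening r S)) {σ : ℝ → ℝ}
    (hσ : ConvexOn ℝ Set.univ σ) (hσ_zero : σ 0 = 0) {ε : ℝ}
    (hε : 0 < ε) {c : ℝ} (hc : 0 < c) :
    ∃ δ > 0, ∀ z ∈ Z, infDist z S < δ → lyapunovCandidate σ q P ε z < c := by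
  have hσc : Continuous σ := continuousOn_univ.1 (hσ.continuousOn isOpen_univ)
  obtain ⟨ρ, hρ, hρσ⟩ := Metric.continuousAt_iff.1 (hσc.continuousAt (x := 0)) (c / 2) (by positivity)
  obtain ⟨δ, hδ, hδq⟩ := Metric.uniformContinuousOn_iff.1 hunif ρ hρ
  have hsqrt : 0 < √(c / (2 * ε)) := Real.sqrt_pos.2 (by positivity)
  -- `δ` controls the `σ` term and the root the quadratic term, each by `c / 2`; `r` keeps `z` where
  -- `q` is uniformly continuous.
  refine ⟨min (min δ r) √(c / (2 * ε)), lt_min (lt_min hδ hr) hsqrt, fun z hz hd => ?_⟩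
  rw [infDist_eq_norm_sub_orthProj hP hz, lt_min_iff, lt_min_iff] at hd
  obtain ⟨⟨hdδ, hdr⟩, hdc⟩ := hd
  have hPS := (hP z hz).1
  have hzr : z ∈ thickening r S := mem_thickening_iff.2 ⟨P z, hPS, by rwa [dist_eq_norm]⟩
  have h1 := hδq z ⟨hz, hzr⟩ (P z) ⟨hSZ hPS, self_subset_thickening hr S hPS⟩
    (by rwa [dist_eq_norm])
  have h2 : σ (q z - q (P z)) < c / 2 := by
    have := hρσ (x := q z - q (P z)) (by rwa [dist_zero_right, ← dist_eq_norm])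
    rw [hσ_zero, dist_zero_right] at this
    exact (le_abs_self _).trans_lt this
  have h3 : ‖z - P z‖ ^ 2 < c / (2 * ε) := (Real.lt_sqrt (norm_nonneg _)).1 hdc
  have h4 : ε * ‖z - P z‖ ^ 2 < c / 2 := by
    calc ε * ‖z - P z‖ ^ 2 < ε * (c / (2 * ε)) := mul_lt_mul_of_pos_left h3 hε
      _ = c / 2 := by field_simp
  unfold lyapunovCandidate
  linarith

end

/-! ### The main theorem -/

theorem proposition2 (d : ℕ)
    -- the latent state space and the function defining the latent set
    (Z : Set (EuclideanSpace ℝ (Fin d))) (hZ : IsOpen Z)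
    (C : EuclideanSpace ℝ (Fin d) → ℝ) (hC : ContDiffOn ℝ 1 C Z)
    (hC0 : ∀ z ∈ Z, C z = 0 → gradient C z ≠ 0)
    -- the latent set, of volume type (with `ξ > 0`) or of surface type (with `ξ = 0`)
    (S : Set (EuclideanSpace ℝ (Fin d))) (ξ : EuclideanSpace ℝ (Fin d) → ℝ)
    (hS : (S = volSet Z C ∧ ∀ z ∈ Z, 0 < ξ z) ∨ (S = surfSet Z C ∧ ∀ z ∈ Z, ξ z = 0))
    (P : EuclideanSpace ℝ (Fin d) → EuclideanSpace ℝ (Fin d)) (hP : IsOrthProjOnto Z S P)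
    -- the ingredients of the Lyapunov candidate
    (q : EuclideanSpace ℝ (Fin d) → ℝ) (hq : ConvexOn ℝ (convexHull ℝ Z) q)
    (σ : ℝ → ℝ) (hσ : ConvexOn ℝ Set.univ σ) (hσ_nonneg : ∀ a, 0 ≤ σ a)
    (hσ_mono : Monotone σ) (hσ_zero : σ 0 = 0)
    (ε : ℝ) (hε : 0 < ε)
    (hV : ∀ z ∈ Z, z ∉ S → DifferentiableAt ℝ (lyapunovCandidate σ q P ε) z)
    -- the base model and the remaining parameters
    (h : EuclideanSpace ℝ (Fin d) → EuclideanSpace ℝ (Fin d))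
    (α : ℝ) (hα : 0 ≤ α)
    (η : EuclideanSpace ℝ (Fin d) → ℝ) (hη : ∀ z ∈ Z, 0 ≤ η z) :
    IsPositivelyInvariant (latentField S C h (lyapunovCandidate σ q P ε) α η ξ) Z S ∧
    ((∃ r : ℝ, 0 < r ∧ UniformContinuousOn q (Z ∩ Metric.thickening r S)) →
      IsStable (latentField S C h (lyapunovCandidate σ q P ε) α η ξ) Z S ∧
      (0 < α →
        IsAsymptoticallyStable (latentField S C h (lyapunovCandidate σ q P ε) α η ξ) Z S)) := by
  have hSZ : S ⊆ Z := by
    rcases hS with ⟨rfl, -⟩ | ⟨rfl, -⟩ <;> exact fun z hz => hz.1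
  have hCS : ∀ z ∈ Z, z ∉ S → C z ≠ 0 := by
    rcases hS with ⟨rfl, -⟩ | ⟨rfl, -⟩
    · exact fun z hz hs h0 => hs ⟨hz, h0.ge⟩
    · exact fun z hz hs h0 => hs ⟨hz, h0⟩
  set V := lyapunovCandidate σ q P ε with hVdef
  set F := latentField S C h V α η ξ with hF
  have hV0 : ∀ z ∈ Z, z ∈ S → V z = 0 := fun z hz hs =>
    lyapunovCandidate_eq_zero hP hσ_zero q ε hz hs
  have hVpos : ∀ z ∈ Z, z ∉ S → 0 < V z := fun z hz hs =>
    lyapunovCandidate_pos hP hσ_nonneg q hε hz hs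
  have hVc : ContinuousOn V Z := continuousOn_lyapunovCandidate hZ hP hq hσ hV
  have hdec : ∀ z ∈ Z, z ∉ S → inner ℝ (gradient V z) (F z) ≤ -α * V z := fun z hz hs =>
    inner_gradient_latentField_le hs (hCS z hz hs) (hη z hz)
      (gradient_lyapunovCandidate_ne_zero hZ hP hSZ hq hσ hσ_nonneg hσ_mono hσ_zero hε hz hs
        (hV z hz hs))
  have hdecay : ∀ (T : ℝ) (z : ℝ → EuclideanSpace ℝ (Fin d)), 0 < T →
      IsSolutionOn F Z (Ico 0 T) z → ∀ t ∈ Ico 0 T, Real.exp (α * t) * V (z t) ≤ V (z 0) := by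
    intro T z _ hz t ht
    simpa using exp_mul_comp_solution_le hVc hV0 hVpos hV hdec hz le_rfl ht.1 ht.2
  have hdist : ∀ z ∈ Z, ε * infDist z S ^ 2 ≤ V z := fun z hz => by
    rw [infDist_eq_norm_sub_orthProj hP hz]
    exact lyapunovCandidate_lower_bound hσ_nonneg q P ε z
  refine ⟨?_, ?_⟩
  · intro T z hT hz hz0 t ht
    by_contra hs
    have h1 := hdecay T z hT hz t ht
    have h2 := mul_pos (Real.exp_pos (α * t)) (hVpos _ (hz.2 t ht).1 hs)
    rw [hV0 _ (hSZ hz0) hz0] at h1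
    linarith
  rintro ⟨r, hr, hunif⟩
  have hstable : IsStable F Z S := by
    intro e he
    -- `V < ε * e ^ 2` forces `dist < e`, as `ε dist² ≤ V`.
    obtain ⟨δ, hδ, hδV⟩ := lyapunovCandidate_uniform_small hP hSZ hr hunif hσ hσ_zero hε
      (show 0 < ε * e ^ 2 by positivity)
    refine ⟨δ, hδ, fun T z hT hz hz0 t ht => ?_⟩
    have h1 := hδV _ (hz.2 0 ⟨le_rfl, hT⟩).1 hz0
    have h2 := hdecay T z hT hz t ht
    have h3 := hdist _ (hz.2 t ht).1
    have h4 : (1 : ℝ) ≤ Real.exp (α * t) := Real.one_le_exp (mul_nonneg hα ht.1)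
    have h5 : 0 ≤ ε * infDist (z t) S ^ 2 := by positivity
    have h6 : V (z t) ≤ Real.exp (α * t) * V (z t) :=
      le_mul_of_one_le_left (h5.trans h3) h4
    have h7 : ε * infDist (z t) S ^ 2 < ε * e ^ 2 := by linarith
    exact lt_of_pow_lt_pow_left₀ 2 he.le (lt_of_mul_lt_mul_left h7 hε.le)
  refine ⟨hstable, fun hα0 => ⟨hstable, fun z hz => ?_⟩⟩
  have hbound : ∀ t, 0 ≤ t → infDist (z t) S ^ 2 ≤ V (z 0) / ε * Real.exp (-(α * t)) := by
    intro t ht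
    have hres : IsSolutionOn F Z (Ico 0 (t + 1)) z :=
      ⟨hz.1.mono Ico_subset_Ici_self, fun s hs => hz.2 s hs.1⟩
    have h1 := hdecay (t + 1) z (by linarith) hres t ⟨ht, by linarith⟩
    have h2 := hdist _ (hz.2 t ht).1
    have h3 := mul_le_mul_of_nonneg_left h2 (Real.exp_pos (α * t)).le
    rw [Real.exp_neg, ← div_eq_mul_inv, div_div, le_div_iff₀ (by positivity)]
    linarith
  have hlim : Tendsto (fun t : ℝ => V (z 0) / ε * Real.exp (-(α * t))) atTop (𝓝 0) := by
    simpa using (Real.tendsto_exp_neg_atTop_nhds_zero.comp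
      (tendsto_id.const_mul_atTop hα0)).const_mul (V (z 0) / ε)
  have hsq : Tendsto (fun t => infDist (z t) S ^ 2) atTop (𝓝 0) := by
    refine squeeze_zero' (Eventually.of_forall fun _ => sq_nonneg _) ?_ hlim
    filter_upwards [eventually_ge_atTop 0] with t ht using hbound t ht
  simpa [Real.sqrt_sq infDist_nonneg] using hsq.sqrt
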